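/- Let $\rho$ be a two-qubit state, i.e. a positive semidefinite operator of trace $1$ on $\mathbb{C}^2\otimes\mathbb{C}^2$. Its fully entangled fraction is $$F(\rho)=\max_{U_A,U_B}\langle\Phi^+|(U_A\otimes U_B)\,\rho\,(U_A\otimes U_B)^\dagger|\Phi^+\rangle ,\qquad |\Phi^+\rangle=\tfrac1{\sqrt2}(|00\rangle+|11\rangle),$$ where $U_A,U_B$ range over the unitary operators on $\mathbb{C}^2$. Its CHSH non-locality is $$NL[\rho]=\max\,(E_{0,0}+E_{0,1}+E_{1,0}-E_{1,1}),\qquad E_{x,y}=P(0,0|x,y)+P(1,1|x,y)-P(0,1|x,y)-P(1,0|x,y),$$ where $P(a,b|x,y)$ is the probability of the outcomes $a,b\in\{0,1\}$ when, on inputs $x,y\in\{0,1\}$, Alice measures her qubit in the orthonormal basis $(|\alpha^x_0\rangle,|\alpha^x_1\rangle)$ of $\mathbb{C}^2$ and Bob measures his in the orthonormal basis $(|\beta^y_0\rangle,|\beta^y_1\rangle)$, i.e. $$P(a,b|x,y)=\mathrm{Tr}\big(\rho\,(|\alpha^x_a\rangle\langle\alpha^x_a|\otimes|\beta^y_b\rangle\langle\beta^y_b|)\big),$$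 and the maximum is over all choices of these four orthonormal bases. If $\frac14\le F(\rho)\le\frac12$, then $NL[\rho]\le 4F(\rho)$. -/

import Mathlib

open scoped Matrix Kronecker ComplexOrder

noncomputable section

/-- Operators on one qubit, as matrices in the computational basis `|0⟩, |1⟩`. -/
abbrev QubitOp : Type := Matrix (Fin 2) (Fin 2) ℂ

/-- Operators on two qubits, in the computational basis `|i j⟩`; the first index is Alice's. -/
abbrev TwoQubitOp : Type := Matrix (Fin 2 × Fin 2) (Fin 2 × Fin 2) ℂ

/-- Unitary operators on one qubit. -/
abbrev QubitUnitary : Type := Matrix.unitaryGroup (Fin 2) ℂ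

/-- A (pure or mixed) two-qubit state: a positive semidefinite operator of trace one. -/
structure IsTwoQubitState (ρ : TwoQubitOp) : Prop where
  posSemidef : ρ.PosSemidef
  trace_eq_one : ρ.trace = 1

/-- The maximally entangled vector `|Φ⁺⟩ = (|00⟩ + |11⟩) / √2`. -/
def phiPlus : Fin 2 × Fin 2 → ℂ :=
  fun p => if p.1 = p.2 then ((1 / Real.sqrt 2 : ℝ) : ℂ) else 0

/-- `⟨Φ⁺| (U_A ⊗ U_B) ρ (U_A ⊗ U_B)† |Φ⁺⟩`, which is a real number if `ρ` is Hermitian. -/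
def phiPlusOverlap (ρ : TwoQubitOp) (UA UB : QubitUnitary) : ℝ :=
  (star phiPlus ⬝ᵥ
    (((UA : QubitOp) ⊗ₖ (UB : QubitOp)) * ρ * ((UA : QubitOp) ⊗ₖ (UB : QubitOp))ᴴ) *ᵥ
      phiPlus).re

/-- The fully entangled fraction `F(ρ)`, the maximum of the overlaps over all local unitaries;
it is attained, see `exists_phiPlusOverlap_eq`. -/
def fullyEntangledFraction (ρ : TwoQubitOp) : ℝ :=
  ⨆ U : QubitUnitary × QubitUnitary, phiPlusOverlap ρ U.1 U.2

/-- The von Neumann measurement of a qubit in the orthonormal basis formed by the columns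
`U|0⟩, U|1⟩` of a unitary `U`: the outcome `a` has the rank-one projector `U |a⟩⟨a| U†`. -/
def basisProj (U : QubitUnitary) (a : Fin 2) : QubitOp :=
  (U : QubitOp) * Matrix.single a a 1 * (U : QubitOp)ᴴ

/-- `P(a, b | x, y)`: the probability of the outcomes `a, b` when on input `x` Alice measures
her qubit of `ρ` in the basis `A x`, and on input `y` Bob measures his in the basis `B y`. -/
def behavior (ρ : TwoQubitOp) (A B : Fin 2 → QubitUnitary) (a b x y : Fin 2) : ℝ :=
  (ρ * (basisProj (A x) a ⊗ₖ basisProj (B y) b)).trace.re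

/-- The correlation function `E_{x,y}` of a behavior `P a b x y = P(a, b | x, y)`. -/
def correlation (P : Fin 2 → Fin 2 → Fin 2 → Fin 2 → ℝ) (x y : Fin 2) : ℝ :=
  P 0 0 x y + P 1 1 x y - P 0 1 x y - P 1 0 x y

/-- The CHSH value `E_{0,0} + E_{0,1} + E_{1,0} - E_{1,1}` of a behavior. -/
def chshValue (P : Fin 2 → Fin 2 → Fin 2 → Fin 2 → ℝ) : ℝ :=
  correlation P 0 0 + correlation P 0 1 + correlation P 1 0 - correlation P 1 1

/-- The CHSH non-locality `NL[ρ]`: the maximal CHSH value that measurements of the two qubits in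
orthonormal bases (that is, of spin observables `n · σ` with `|n| = 1`) attain on `ρ`;
it is attained, see `exists_chshValue_eq`. -/
def nonLocality (ρ : TwoQubitOp) : ℝ :=
  ⨆ M : (Fin 2 → QubitUnitary) × (Fin 2 → QubitUnitary), chshValue (behavior ρ M.1 M.2)

instance qubitUnitary_compactSpace : CompactSpace QubitUnitary := by
  have hK : IsCompact (Set.pi Set.univ fun _ : Fin 2 => Set.pi Set.univ fun _ : Fin 2 =>
      Metric.closedBall (0 : ℂ) 1) :=
    isCompact_univ_pi fun _ => isCompact_univ_pi fun _ => isCompact_closedBall _ _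
  refine isCompact_iff_compactSpace.1 (hK.of_isClosed_subset
    (?_ : IsClosed {U : QubitOp | U ∈ Matrix.unitaryGroup (Fin 2) ℂ}) fun U hU i _ j _ => ?_)
  · simp only [Matrix.mem_unitaryGroup_iff]
    exact isClosed_eq (by fun_prop) continuous_const
  · simpa using entry_norm_bound_of_unitary hU i j

theorem continuous_phiPlusOverlap (ρ : TwoQubitOp) :
    Continuous fun U : QubitUnitary × QubitUnitary => phiPlusOverlap ρ U.1 U.2 := by
  have hk : Continuous fun U : QubitUnitary × QubitUnitary =>
      ((U.1 : QubitOp) ⊗ₖ (U.2 : QubitOp)) := by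
    refine continuous_matrix fun i j => ?_
    simp only [Matrix.kroneckerMap_apply]
    exact ((continuous_subtype_val.comp continuous_fst).matrix_elem _ _).mul
      ((continuous_subtype_val.comp continuous_snd).matrix_elem _ _)
  unfold phiPlusOverlap
  fun_prop

theorem continuous_basisProj (a : Fin 2) : Continuous fun U : QubitUnitary => basisProj U a := by
  unfold basisProj
  fun_prop

theorem continuous_chshValue (ρ : TwoQubitOp) :
    Continuous fun M : (Fin 2 → QubitUnitary) × (Fin 2 → QubitUnitary) =>
      chshValue (behavior ρ M.1 M.2) := by
  have hb : ∀ a b x y : Fin 2, Continuous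
      fun M : (Fin 2 → QubitUnitary) × (Fin 2 → QubitUnitary) => behavior ρ M.1 M.2 a b x y := by
    intro a b x y
    have h1 := (continuous_basisProj a).comp
      (by fun_prop : Continuous fun M : (Fin 2 → QubitUnitary) × (Fin 2 → QubitUnitary) => M.1 x)
    have h2 := (continuous_basisProj b).comp
      (by fun_prop : Continuous fun M : (Fin 2 → QubitUnitary) × (Fin 2 → QubitUnitary) => M.2 y)
    have hk : Continuous fun M : (Fin 2 → QubitUnitary) × (Fin 2 → QubitUnitary) =>
        basisProj (M.1 x) a ⊗ₖ basisProj (M.2 y) b := by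
      refine continuous_matrix fun i j => ?_
      simp only [Matrix.kroneckerMap_apply]
      exact (h1.matrix_elem _ _).mul (h2.matrix_elem _ _)
    unfold behavior
    fun_prop
  unfold chshValue correlation
  fun_prop

/-- The supremum in the definition of `F(ρ)` is a maximum. -/
theorem exists_phiPlusOverlap_eq (ρ : TwoQubitOp) :
    ∃ UA UB : QubitUnitary, phiPlusOverlap ρ UA UB = fullyEntangledFraction ρ ∧
      ∀ VA VB : QubitUnitary, phiPlusOverlap ρ VA VB ≤ phiPlusOverlap ρ UA UB := by
  obtain ⟨U, -, hU⟩ := isCompact_univ.exists_isMaxOn Set.univ_nonempty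
    (continuous_phiPlusOverlap ρ).continuousOn
  have h : ∀ V : QubitUnitary × QubitUnitary,
      phiPlusOverlap ρ V.1 V.2 ≤ phiPlusOverlap ρ U.1 U.2 := fun V => hU (Set.mem_univ V)
  exact ⟨U.1, U.2, le_antisymm (le_ciSup ⟨_, Set.forall_mem_range.2 h⟩ U) (ciSup_le h),
    fun VA VB => h (VA, VB)⟩

/-- The supremum in the definition of `NL[ρ]` is a maximum. -/
theorem exists_chshValue_eq (ρ : TwoQubitOp) :
    ∃ A B : Fin 2 → QubitUnitary, chshValue (behavior ρ A B) = nonLocality ρ ∧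
      ∀ A' B' : Fin 2 → QubitUnitary,
        chshValue (behavior ρ A' B') ≤ chshValue (behavior ρ A B) := by
  obtain ⟨M, -, hM⟩ := isCompact_univ.exists_isMaxOn Set.univ_nonempty
    (continuous_chshValue ρ).continuousOn
  have h : ∀ N : (Fin 2 → QubitUnitary) × (Fin 2 → QubitUnitary),
      chshValue (behavior ρ N.1 N.2) ≤ chshValue (behavior ρ M.1 M.2) :=
    fun N => hM (Set.mem_univ N)
  exact ⟨M.1, M.2, le_antisymm (le_ciSup (f := fun N : (Fin 2 → QubitUnitary) ×
    (Fin 2 → QubitUnitary) => chshValue (behavior ρ N.1 N.2)) ⟨_, Set.forall_mem_range.2 h⟩ M)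
    (ciSup_le h), fun A' B' => h (A', B')⟩

end

/-! Two Bloch vectors span at most a plane, so each party has a basis in which both of its
observables are off-diagonal, with unimodular entries `w x`, `v y` (`exists_basisObs_eq_offDiag`).
In these bases the CHSH value sees only two coherences of the rotated state σ, namely r₁ = σ₀₀,₁₁
and r₂ = σ₀₁,₁₀: it equals 2 Re(r₁c) + 2 Re(r₂d), where |c|² + |d|² = 8 (`sum_sq_norm_chsh_coeff`)
and hence |c| + |d| ≤ 4. Overlaps with (|00⟩ + s̄|11⟩)/√2 and (|01⟩ + s̄|10⟩)/√2 lie between 0 and F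
for every phase s, which forces 2|rᵢ| ≤ F (`two_mul_norm_le_of_phase`). Together the value is at
most F(|c| + |d|) ≤ 4F. -/

/-- The observable with value `1` on the first basis vector and `-1` on the second. -/
def basisObs (U : QubitUnitary) : QubitOp := basisProj U 0 - basisProj U 1

/-- The Hermitian off-diagonal operator with lower left entry `w`. -/
def offDiag (w : ℂ) : QubitOp := !![0, star w; w, 0]

theorem basisObs_eq (U : QubitUnitary) :
    basisObs U = (U : QubitOp) * !![1, 0; 0, -1] * (U : QubitOp)ᴴ := by
  unfold basisObs basisProj
  rw [← sub_mul, ← mul_sub]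
  congr 2
  ext i j
  fin_cases i <;> fin_cases j <;> simp [Matrix.single]

theorem QubitUnitary.conjTranspose_mul_self (U : QubitUnitary) :
    (U : QubitOp)ᴴ * (U : QubitOp) = 1 := Matrix.mem_unitaryGroup_iff'.1 U.2

theorem QubitUnitary.mul_conjTranspose_self (U : QubitUnitary) :
    (U : QubitOp) * (U : QubitOp)ᴴ = 1 := Matrix.mem_unitaryGroup_iff.1 U.2

theorem isHermitian_basisObs (U : QubitUnitary) : (basisObs U).IsHermitian := by
  rw [basisObs_eq]
  refine Matrix.isHermitian_mul_mul_conjTranspose _ ?_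
  ext i j
  fin_cases i <;> fin_cases j <;> simp

theorem trace_basisObs (U : QubitUnitary) : (basisObs U).trace = 0 := by
  rw [basisObs_eq, Matrix.trace_mul_comm, ← mul_assoc, U.conjTranspose_mul_self, one_mul]
  simp [Matrix.trace_fin_two]

theorem basisObs_mul_self (U : QubitUnitary) : basisObs U * basisObs U = 1 := by
  have hZ : (!![1, 0; 0, -1] : QubitOp) * !![1, 0; 0, -1] = 1 := by
    ext i j
    fin_cases i <;> fin_cases j <;> simp [Matrix.mul_apply]
  calc basisObs U * basisObs U
      = (U : QubitOp) * !![1, 0; 0, -1] * ((U : QubitOp)ᴴ * (U : QubitOp)) *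
          !![1, 0; 0, -1] * (U : QubitOp)ᴴ := by
        rw [basisObs_eq]; simp only [mul_assoc]
    _ = (U : QubitOp) * (!![1, 0; 0, -1] * !![1, 0; 0, -1]) * (U : QubitOp)ᴴ := by
        rw [U.conjTranspose_mul_self, mul_one]; simp only [mul_assoc]
    _ = 1 := by rw [hZ, mul_one, U.mul_conjTranspose_self]

theorem eq_offDiag {N : QubitOp} (hN : N.IsHermitian) (htr : N.trace = 0) (hsq : N * N = 1)
    (h0 : N 0 0 = 0) : ‖N 1 0‖ = 1 ∧ N = offDiag (N 1 0) := by
  have h1 : N 1 1 = 0 := by simpa [Matrix.trace_fin_two, h0] using htr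
  have h01 : N 0 1 = star (N 1 0) := (hN.apply 0 1).symm
  constructor
  · have h := congrFun (congrFun hsq 0) 0
    rw [Matrix.mul_apply, Fin.sum_univ_two, h0, h01] at h
    have h' : ‖N 1 0‖ * ‖N 1 0‖ = 1 := by
      have := congrArg norm h
      simpa using this
    nlinarith [norm_nonneg (N 1 0)]
  · ext i j
    fin_cases i <;> fin_cases j <;> simp [offDiag, h0, h1, h01]

/-- Supplies the phase of `equatorialUnitary`: z along i·b̄ makes b z purely imaginary. -/
theorem exists_norm_eq_one_mul_re_eq_zero (b : ℂ) : ∃ z : ℂ, ‖z‖ = 1 ∧ (b * z).re = 0 := by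
  by_cases hb : b = 0
  · exact ⟨1, by simp, by simp [hb]⟩
  · have hn : ‖b‖ ≠ 0 := norm_ne_zero_iff.2 hb
    refine ⟨Complex.I * star b / ‖b‖, by simp [hn], ?_⟩
    rw [← mul_div_assoc, Complex.div_ofReal_re]
    simp
    ring_nf
    simp

/-- The unitary with columns `(1, z) / √2` and `(1, -z) / √2`. -/
noncomputable def equatorialUnitary (z : ℂ) (hz : ‖z‖ = 1) : QubitUnitary :=
  ⟨((1 / Real.sqrt 2 : ℝ) : ℂ) • !![1, 1; z, -z], by
    have h2 : ((1 / Real.sqrt 2 : ℝ) : ℂ) * ((1 / Real.sqrt 2 : ℝ) : ℂ) = 1 / 2 := by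
      rw [← Complex.ofReal_mul, div_mul_div_comm, Real.mul_self_sqrt (by norm_num)]
      norm_num
    have hzz : (starRingEnd ℂ) z * z = 1 := by rw [Complex.conj_mul', hz]; norm_num
    rw [Matrix.mem_unitaryGroup_iff', Matrix.star_eq_conjTranspose, Matrix.conjTranspose_smul,
      Matrix.smul_mul, Matrix.mul_smul, smul_smul, Complex.star_def, Complex.conj_ofReal, h2]
    ext i j
    fin_cases i <;> fin_cases j <;>
      simp [Matrix.mul_apply, Fin.sum_univ_two, hzz] <;> norm_num⟩

/-- The entry is the expectation of M in (1, z)/√2, that is (tr M)/2 + Re(M₀₁z). -/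
theorem equatorialUnitary_conj_zero_zero {z : ℂ} (hz : ‖z‖ = 1) {M : QubitOp}
    (hM : M.IsHermitian) (htr : M.trace = 0) (h : (M 0 1 * z).re = 0) :
    ((equatorialUnitary z hz : QubitOp)ᴴ * M * (equatorialUnitary z hz : QubitOp)) 0 0 = 0 := by
  have hzz : (starRingEnd ℂ) z * z = 1 := by rw [Complex.conj_mul', hz]; norm_num
  have h11 : M 1 1 = - M 0 0 := by
    rw [Matrix.trace_fin_two] at htr
    exact (neg_eq_of_add_eq_zero_right htr).symm
  have h10 : M 1 0 = (starRingEnd ℂ) (M 0 1) := (hM.apply 1 0).symm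
  have hre : M 0 1 * z + (starRingEnd ℂ) (M 0 1 * z) = 0 := by
    rw [Complex.add_conj, h]; simp
  rw [map_mul] at hre
  simp only [equatorialUnitary, Matrix.conjTranspose_smul, Matrix.smul_mul, Matrix.mul_smul,
    smul_smul, Matrix.smul_apply]
  refine smul_eq_zero_of_right _ ?_
  simp [Matrix.mul_apply, Fin.sum_univ_two, h11, h10]
  linear_combination hre - M 0 0 * hzz

/-- Two spin observables of a qubit are simultaneously off-diagonal in some orthonormal basis. -/
theorem exists_basisObs_eq_offDiag (A : Fin 2 → QubitUnitary) :
    ∃ (V : QubitUnitary) (w : Fin 2 → ℂ), ∀ x, ‖w x‖ = 1 ∧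
      basisObs (A x) = (V : QubitOp) * offDiag (w x) * (V : QubitOp)ᴴ := by
  -- In the eigenbasis of the first observable, `M 0` is already diagonal, so z only has to be
  -- adapted to `M 1`.
  let M : Fin 2 → QubitOp := fun x => (A 0 : QubitOp)ᴴ * basisObs (A x) * (A 0 : QubitOp)
  have hMh : ∀ x, (M x).IsHermitian := fun x =>
    Matrix.isHermitian_conjTranspose_mul_mul _ (isHermitian_basisObs _)
  have hMt : ∀ x, (M x).trace = 0 := fun x => by
    simp only [M]
    rw [Matrix.trace_mul_comm, ← mul_assoc, (A 0).mul_conjTranspose_self, one_mul,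
      trace_basisObs]
  obtain ⟨z, hz, hre⟩ := exists_norm_eq_one_mul_re_eq_zero (M 1 0 1)
  have hM0 : M 0 = !![1, 0; 0, -1] := by
    simp only [M, basisObs_eq]
    rw [mul_assoc, mul_assoc, (A 0).conjTranspose_mul_self, mul_one, ← mul_assoc,
      (A 0).conjTranspose_mul_self, one_mul]
  have hre' : ∀ x, (M x 0 1 * z).re = 0 := by
    rw [Fin.forall_fin_two]
    exact ⟨by simp [hM0], hre⟩
  let V : QubitUnitary := A 0 * equatorialUnitary z hz
  let N : Fin 2 → QubitOp := fun x => (V : QubitOp)ᴴ * basisObs (A x) * (V : QubitOp)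
  have hN : ∀ x, basisObs (A x) = (V : QubitOp) * N x * (V : QubitOp)ᴴ := fun x => by
    calc basisObs (A x) = ((V : QubitOp) * (V : QubitOp)ᴴ) * basisObs (A x) *
          ((V : QubitOp) * (V : QubitOp)ᴴ) := by
          rw [V.mul_conjTranspose_self, one_mul, mul_one]
      _ = _ := by simp only [N, mul_assoc]
  have key : ∀ x, ‖N x 1 0‖ = 1 ∧ N x = offDiag (N x 1 0) := fun x => by
    refine eq_offDiag (Matrix.isHermitian_conjTranspose_mul_mul _ (isHermitian_basisObs _))
      ?_ ?_ ?_
    · simp only [N]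
      rw [Matrix.trace_mul_comm, ← mul_assoc, V.mul_conjTranspose_self, one_mul, trace_basisObs]
    · calc N x * N x = (V : QubitOp)ᴴ * basisObs (A x) * ((V : QubitOp) * (V : QubitOp)ᴴ) *
            basisObs (A x) * (V : QubitOp) := by simp only [N, mul_assoc]
        _ = (V : QubitOp)ᴴ * (basisObs (A x) * basisObs (A x)) * (V : QubitOp) := by
            rw [V.mul_conjTranspose_self, mul_one]; simp only [mul_assoc]
        _ = 1 := by rw [basisObs_mul_self, mul_one, V.conjTranspose_mul_self]
    · have h := equatorialUnitary_conj_zero_zero hz (hMh x) (hMt x) (hre' x)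
      have hV : (V : QubitOp) = (A 0 : QubitOp) * (equatorialUnitary z hz : QubitOp) := rfl
      simpa only [N, hV, M, Matrix.conjTranspose_mul, mul_assoc] using h
  exact ⟨V, fun x => N x 1 0, fun x => ⟨(key x).1, by rw [← (key x).2]; exact hN x⟩⟩

/-! ### Correlations as coherences of the rotated state -/

theorem correlation_behavior (ρ : TwoQubitOp) (A B : Fin 2 → QubitUnitary) (x y : Fin 2) :
    correlation (behavior ρ A B) x y =
      (ρ * (basisObs (A x) ⊗ₖ basisObs (B y))).trace.re := by
  have h : basisObs (A x) ⊗ₖ basisObs (B y) =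
      basisProj (A x) 0 ⊗ₖ basisProj (B y) 0 + basisProj (A x) 1 ⊗ₖ basisProj (B y) 1 -
        basisProj (A x) 0 ⊗ₖ basisProj (B y) 1 - basisProj (A x) 1 ⊗ₖ basisProj (B y) 0 := by
    ext p q
    simp only [basisObs, Matrix.kroneckerMap_apply, Matrix.sub_apply, Matrix.add_apply]
    ring
  simp only [correlation, behavior, h, mul_sub, mul_add, Matrix.trace_sub, Matrix.trace_add,
    Complex.sub_re, Complex.add_re]

/-- A product of off-diagonal operators flips both qubits, so only antidiagonal entries of σ
contribute; hermiticity pairs them into real parts. -/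
theorem trace_mul_offDiag_kronecker_re {σ : TwoQubitOp} (hσ : σ.IsHermitian) (w v : ℂ) :
    (σ * (offDiag w ⊗ₖ offDiag v)).trace.re =
      2 * (σ (0, 0) (1, 1) * (w * v)).re + 2 * (σ (0, 1) (1, 0) * (w * star v)).re := by
  have h1 : σ (1, 1) (0, 0) = (starRingEnd ℂ) (σ (0, 0) (1, 1)) := (hσ.apply _ _).symm
  have h2 : σ (1, 0) (0, 1) = (starRingEnd ℂ) (σ (0, 1) (1, 0)) := (hσ.apply _ _).symm
  simp [Matrix.trace, Matrix.mul_apply, Fintype.sum_prod_type, Fin.sum_univ_two, offDiag, h1, h2]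
  ring

/-- The state `(V ⊗ W)† ρ (V ⊗ W)`. -/
def localConj (ρ : TwoQubitOp) (V W : QubitUnitary) : TwoQubitOp :=
  ((V : QubitOp) ⊗ₖ (W : QubitOp))ᴴ * ρ * ((V : QubitOp) ⊗ₖ (W : QubitOp))

theorem trace_mul_conj_kronecker (ρ : TwoQubitOp) (V W : QubitUnitary) (D D' : QubitOp) :
    (ρ * (((V : QubitOp) * D * (V : QubitOp)ᴴ) ⊗ₖ
      ((W : QubitOp) * D' * (W : QubitOp)ᴴ))).trace =
      (localConj ρ V W * (D ⊗ₖ D')).trace := by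
  rw [localConj, Matrix.mul_kronecker_mul, Matrix.mul_kronecker_mul,
    ← Matrix.conjTranspose_kronecker, ← mul_assoc, Matrix.trace_mul_comm]
  simp only [mul_assoc]

/-! ### Bounding the coherences by the fully entangled fraction -/

theorem phiPlusOverlap_localConj (ρ : TwoQubitOp) (V W UA UB : QubitUnitary) :
    phiPlusOverlap (localConj ρ V W) UA UB =
      phiPlusOverlap ρ (UA * V⁻¹) (UB * W⁻¹) := by
  have h : ((UA * V⁻¹ : QubitUnitary) : QubitOp) ⊗ₖ ((UB * W⁻¹ : QubitUnitary) : QubitOp) =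
      ((UA : QubitOp) ⊗ₖ (UB : QubitOp)) * ((V : QubitOp) ⊗ₖ (W : QubitOp))ᴴ := by
    rw [Matrix.conjTranspose_kronecker, ← Matrix.mul_kronecker_mul]
    rfl
  simp only [phiPlusOverlap, localConj, h, Matrix.conjTranspose_mul,
    Matrix.conjTranspose_conjTranspose, mul_assoc]

theorem phiPlusOverlap_le (ρ : TwoQubitOp) (UA UB : QubitUnitary) :
    phiPlusOverlap ρ UA UB ≤ fullyEntangledFraction ρ := by
  obtain ⟨VA, VB, h, hmax⟩ := exists_phiPlusOverlap_eq ρ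
  exact (hmax UA UB).trans h.le

theorem phiPlusOverlap_nonneg {ρ : TwoQubitOp} (hρ : ρ.PosSemidef) (UA UB : QubitUnitary) :
    0 ≤ phiPlusOverlap ρ UA UB :=
  (hρ.mul_mul_conjTranspose_same _).re_dotProduct_nonneg phiPlus

/-- The diagonal unitary with entries `1, s`. -/
def phaseUnitary (s : ℂ) (hs : ‖s‖ = 1) : QubitUnitary :=
  ⟨!![1, 0; 0, s], by
    rw [Matrix.mem_unitaryGroup_iff']
    ext i j
    fin_cases i <;> fin_cases j <;>
      simp [Matrix.mul_apply, Fin.sum_univ_two, Matrix.star_eq_conjTranspose,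
        Complex.conj_mul', hs]⟩

/-- The unitary exchanging the two basis vectors up to a phase `s`. -/
def flipUnitary (s : ℂ) (hs : ‖s‖ = 1) : QubitUnitary :=
  ⟨!![0, 1; s, 0], by
    rw [Matrix.mem_unitaryGroup_iff']
    ext i j
    fin_cases i <;> fin_cases j <;>
      simp [Matrix.mul_apply, Fin.sum_univ_two, Matrix.star_eq_conjTranspose,
        Complex.conj_mul', hs]⟩

theorem phiPlusOverlap_eq_sum (ρ : TwoQubitOp) (U : QubitUnitary) :
    phiPlusOverlap ρ 1 U = (1 / 2) * (∑ i : Fin 2, ∑ j : Fin 2,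
      ((((1 : QubitOp) ⊗ₖ (U : QubitOp)) * ρ * ((1 : QubitOp) ⊗ₖ (U : QubitOp))ᴴ)
        (i, i) (j, j)).re) := by
  have h2 : (√2)⁻¹ * (√2)⁻¹ = (1 / 2 : ℝ) := by
    rw [← mul_inv, Real.mul_self_sqrt (by norm_num)]; norm_num
  rw [phiPlusOverlap, OneMemClass.coe_one]
  generalize ((1 : QubitOp) ⊗ₖ (U : QubitOp)) * ρ * ((1 : QubitOp) ⊗ₖ (U : QubitOp))ᴴ = X
  simp [dotProduct, Matrix.mulVec, Fintype.sum_prod_type, Fin.sum_univ_two, phiPlus, -one_div,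
    -Complex.ofReal_div]
  linear_combination ((X (0, 0) (0, 0)).re + (X (0, 0) (1, 1)).re + (X (1, 1) (0, 0)).re +
    (X (1, 1) (1, 1)).re) * h2

/-- The adjoint of 1 ⊗ U takes Φ⁺ to (|00⟩ + s̄|11⟩)/√2. -/
theorem phiPlusOverlap_phaseUnitary {σ : TwoQubitOp} (hσ : σ.IsHermitian) (s : ℂ)
    (hs : ‖s‖ = 1) :
    phiPlusOverlap σ 1 (phaseUnitary s hs) =
      (1 / 2) * ((σ (0, 0) (0, 0)).re + (σ (1, 1) (1, 1)).re) +
        (σ (0, 0) (1, 1) * star s).re := by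
  have h1 : σ (1, 1) (0, 0) = (starRingEnd ℂ) (σ (0, 0) (1, 1)) := (hσ.apply _ _).symm
  have hss : s.re * s.re + s.im * s.im = 1 := by
    rw [← Complex.normSq_apply, Complex.normSq_eq_norm_sq, hs]; norm_num
  rw [phiPlusOverlap_eq_sum]
  simp [Matrix.mul_apply, Fintype.sum_prod_type, Fin.sum_univ_two, phaseUnitary,
    Matrix.one_apply, h1]
  linear_combination (1 / 2) * (σ (1, 1) (1, 1)).re * hss

/-- Here Φ⁺ is taken to (|01⟩ + s̄|10⟩)/√2. -/
theorem phiPlusOverlap_flipUnitary {σ : TwoQubitOp} (hσ : σ.IsHermitian) (s : ℂ)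
    (hs : ‖s‖ = 1) :
    phiPlusOverlap σ 1 (flipUnitary s hs) =
      (1 / 2) * ((σ (0, 1) (0, 1)).re + (σ (1, 0) (1, 0)).re) +
        (σ (0, 1) (1, 0) * star s).re := by
  have h1 : σ (1, 0) (0, 1) = (starRingEnd ℂ) (σ (0, 1) (1, 0)) := (hσ.apply _ _).symm
  have hss : s.re * s.re + s.im * s.im = 1 := by
    rw [← Complex.normSq_apply, Complex.normSq_eq_norm_sq, hs]; norm_num
  rw [phiPlusOverlap_eq_sum]
  simp [Matrix.mul_apply, Fintype.sum_prod_type, Fin.sum_univ_two, flipUnitary,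
    Matrix.one_apply, h1]
  linear_combination (1 / 2) * (σ (1, 0) (1, 0)).re * hss

theorem exists_norm_eq_one_mul_star_eq_norm (r : ℂ) :
    ∃ s : ℂ, ‖s‖ = 1 ∧ r * star s = ‖r‖ := by
  by_cases hr : r = 0
  · exact ⟨1, by simp, by simp [hr]⟩
  · have hn : ‖r‖ ≠ 0 := norm_ne_zero_iff.2 hr
    have hn' : (‖r‖ : ℂ) ≠ 0 := Complex.ofReal_ne_zero.2 hn
    refine ⟨r / ‖r‖, by simp [hn], ?_⟩
    rw [Complex.star_def, map_div₀, Complex.conj_ofReal, ← mul_div_assoc, Complex.mul_conj',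
      sq, mul_div_assoc, div_self hn', mul_one]

/-- If `m + Re (r s̄)` stays between `0` and `F` for all phases `s`, then `2 |r| ≤ F`. -/
theorem two_mul_norm_le_of_phase {m F : ℝ} {r : ℂ}
    (h : ∀ s : ℂ, ‖s‖ = 1 → 0 ≤ m + (r * star s).re ∧ m + (r * star s).re ≤ F) :
    2 * ‖r‖ ≤ F := by
  obtain ⟨s, hs, hrs⟩ := exists_norm_eq_one_mul_star_eq_norm r
  have h1 := (h s hs).2
  -- The opposite phase gives |r| ≤ m, while s itself gives m + |r| ≤ F.
  have h2 := (h (-s) (by rw [norm_neg, hs])).1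
  rw [star_neg, mul_neg, hrs, Complex.neg_re, Complex.ofReal_re] at h2
  rw [hrs, Complex.ofReal_re] at h1
  linarith

/-! ### The CHSH coefficients and the final bound -/

/-- Group each sum as w₀(v₀ + v₁) + w₁(v₀ − v₁). The squared moduli of the two terms add up to 4 by
the parallelogram law. Since (v₀ + v₁)·conj(v₀ − v₁) is purely imaginary, conjugating the v's
reverses the sign of the cross term, and the two cross terms cancel. -/
theorem sum_sq_norm_chsh_coeff (w v : Fin 2 → ℂ) (hw : ∀ x, ‖w x‖ = 1) (hv : ∀ y, ‖v y‖ = 1) :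
    ‖w 0 * v 0 + w 0 * v 1 + w 1 * v 0 - w 1 * v 1‖ ^ 2 +
      ‖w 0 * star (v 0) + w 0 * star (v 1) + w 1 * star (v 0) - w 1 * star (v 1)‖ ^ 2 = 8 := by
  have h : ∀ z : ℂ, ‖z‖ = 1 → z.re * z.re + z.im * z.im = 1 := fun z hz => by
    rw [← Complex.normSq_apply, Complex.normSq_eq_norm_sq, hz]; norm_num
  have hw0 := h _ (hw 0)
  have hw1 := h _ (hw 1)
  have hv0 := h _ (hv 0)
  have hv1 := h _ (hv 1)
  rw [← Complex.normSq_eq_norm_sq, ← Complex.normSq_eq_norm_sq, Complex.normSq_apply,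
    Complex.normSq_apply]
  simp
  generalize (w 0).re = a at *
  generalize (w 0).im = b at *
  generalize (w 1).re = c at *
  generalize (w 1).im = d at *
  generalize (v 0).re = p at *
  generalize (v 0).im = q at *
  generalize (v 1).re = r at *
  generalize (v 1).im = s at *
  linear_combination (2 * (p * p + q * q + r * r + s * s) + 4 * (p * r + q * s)) * hw0 +
    (2 * (p * p + q * q + r * r + s * s) - 4 * (p * r + q * s)) * hw1 +
    (4 + 4 * (a * c + b * d)) * hv0 + (4 - 4 * (a * c + b * d)) * hv1

theorem chshValue_behavior_le {ρ : TwoQubitOp} (hρ : ρ.PosSemidef)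
    (A B : Fin 2 → QubitUnitary) :
    chshValue (behavior ρ A B) ≤ 4 * fullyEntangledFraction ρ := by
  obtain ⟨V, w, hA⟩ := exists_basisObs_eq_offDiag A
  obtain ⟨W, v, hB⟩ := exists_basisObs_eq_offDiag B
  have hσ : (localConj ρ V W).PosSemidef := hρ.conjTranspose_mul_mul_same _
  -- Local unitaries are absorbed into the maximum defining F, so rotating the state keeps the
  -- bound.
  have hF : ∀ U, 0 ≤ phiPlusOverlap (localConj ρ V W) 1 U ∧
      phiPlusOverlap (localConj ρ V W) 1 U ≤ fullyEntangledFraction ρ := fun U =>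
    ⟨phiPlusOverlap_nonneg hσ 1 U, by
      rw [phiPlusOverlap_localConj]; exact phiPlusOverlap_le _ _ _⟩
  have hcorr : ∀ x y, correlation (behavior ρ A B) x y =
      2 * (localConj ρ V W (0, 0) (1, 1) * (w x * v y)).re +
        2 * (localConj ρ V W (0, 1) (1, 0) * (w x * star (v y))).re := fun x y => by
    rw [correlation_behavior, (hA x).2, (hB y).2, trace_mul_conj_kronecker,
      trace_mul_offDiag_kronecker_re hσ.isHermitian]
  have h1 : 2 * ‖localConj ρ V W (0, 0) (1, 1)‖ ≤ fullyEntangledFraction ρ :=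
    two_mul_norm_le_of_phase fun s hs => by
      rw [← phiPlusOverlap_phaseUnitary hσ.isHermitian s hs]; exact hF _
  have h2 : 2 * ‖localConj ρ V W (0, 1) (1, 0)‖ ≤ fullyEntangledFraction ρ :=
    two_mul_norm_le_of_phase fun s hs => by
      rw [← phiPlusOverlap_flipUnitary hσ.isHermitian s hs]; exact hF _
  generalize localConj ρ V W (0, 0) (1, 1) = r₁ at *
  generalize localConj ρ V W (0, 1) (1, 0) = r₂ at *
  have hsq := sum_sq_norm_chsh_coeff w v (fun x => (hA x).1) fun y => (hB y).1
  have hval : chshValue (behavior ρ A B) =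
      2 * (r₁ * (w 0 * v 0 + w 0 * v 1 + w 1 * v 0 - w 1 * v 1)).re +
      2 * (r₂ * (w 0 * star (v 0) + w 0 * star (v 1) + w 1 * star (v 0) -
        w 1 * star (v 1))).re := by
    simp only [chshValue, hcorr, mul_add, mul_sub, Complex.add_re, Complex.sub_re]
    ring
  generalize w 0 * v 0 + w 0 * v 1 + w 1 * v 0 - w 1 * v 1 = c at *
  generalize w 0 * star (v 0) + w 0 * star (v 1) + w 1 * star (v 0) - w 1 * star (v 1) = d at *
  -- (|c| + |d|)² ≤ 2(|c|² + |d|²) = 16.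
  have hcd : ‖c‖ + ‖d‖ ≤ 4 := by nlinarith [sq_nonneg (‖c‖ - ‖d‖)]
  have hb : ∀ r e : ℂ, 2 * ‖r‖ ≤ fullyEntangledFraction ρ →
      2 * (r * e).re ≤ fullyEntangledFraction ρ * ‖e‖ := fun r e hr => by
    calc 2 * (r * e).re ≤ 2 * (‖r‖ * ‖e‖) := by
          rw [← norm_mul]; linarith [Complex.re_le_norm (r * e)]
      _ = 2 * ‖r‖ * ‖e‖ := by ring
      _ ≤ _ := mul_le_mul_of_nonneg_right hr (norm_nonneg e)
  have h0 : 0 ≤ fullyEntangledFraction ρ := (hF 1).1.trans (hF 1).2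
  rw [hval]
  calc _ ≤ fullyEntangledFraction ρ * (‖c‖ + ‖d‖) := by
        linarith [hb r₁ c h1, hb r₂ d h2]
    _ ≤ fullyEntangledFraction ρ * 4 := mul_le_mul_of_nonneg_left hcd h0
    _ = _ := mul_comm _ _

theorem mainTheorem9 (ρ : TwoQubitOp) (hρ : IsTwoQubitState ρ)
    (hF₁ : 1 / 4 ≤ fullyEntangledFraction ρ) (hF₂ : fullyEntangledFraction ρ ≤ 1 / 2) :
    nonLocality ρ ≤ 4 * fullyEntangledFraction ρ := by
  obtain ⟨A, B, h, -⟩ := exists_chshValue_eq ρ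
  rw [← h]
  exact chshValue_behavior_le hρ.posSemidef A B
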